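/- Graphs are finite, simple and undirected. For a graph $G$, a set $A\subseteq V(G)$ and $r\in\mathbb{N}$, let $\mathrm{dist}^r_G(v,w)$ equal $\mathrm{dist}_G(v,w)$ if $\mathrm{dist}_G(v,w)\le r$, and $\infty$ otherwise. For $v\in V(G)\setminus A$, let $\pi^r_G(v,A):=\{(w,\mathrm{dist}^r_G(v,w)) : w\in A\}$, and let $\pi^r_G(A):=|\{\pi^r_G(v,A) : v\in V(G)\setminus A\}|$. A graph is $K_t$-minor-free if it does not contain the complete graph $K_t$ on $t$ vertices as a minor. There is a function $\varepsilon:\mathbb{N}\to\mathbb{R}$ with $\varepsilon(t)=o(t)$ as $t\to\infty$ such that for every $t\in\mathbb{N}$, every $K_t$-minor-free graph $G$ and every set $A\subseteq V(G)$, $$\pi^1_G(A)\le 3^{2t/3+\varepsilon(t)}\,|A|+1 .$$ This is tight up to the $o(t)$ term, and more precisely: there is a function $\delta:\mathbb{N}\to\mathbb{R}$ with $\delta(t)=O(\log t)$ as $t\to\infty$ such that for every integer $t\ge 2$ there are a $K_t$-minor-free graph $G$ and a non-empty set $A\subseteq V(G)$ with $$\pi^1_G(A)\ge 3^{2t/3-\delta(t)}\,|A|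 .$$ -/

import Mathlib

open Filter Asymptotics

namespace SimpleGraph

/-- `H` is a minor of `G`: there are pairwise disjoint branch sets in `G`, one for each vertex of
`H`, each inducing a (nonempty) connected subgraph of `G`, such that for each edge `vw` of `H` some
edge of `G` joins the branch set of `v` to the branch set of `w`. -/
def IsMinorOf {W V : Type*} (H : SimpleGraph W) (G : SimpleGraph V) : Prop :=
  ∃ B : W → Set V,
    (∀ v, (G.induce (B v)).Connected) ∧
    (∀ v w, v ≠ w → Disjoint (B v) (B w)) ∧
    ∀ v w, H.Adj v w → ∃ x ∈ B v, ∃ y ∈ B w, G.Adj x y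

/-- `G` is `K_t`-minor-free. -/
def CompleteMinorFree {V : Type*} (t : ℕ) (G : SimpleGraph V) : Prop :=
  ¬ (completeGraph (Fin t)).IsMinorOf G

variable {V : Type*} (G : SimpleGraph V)

open Classical in
/-- The distance between `v` and `w` in `G` if it is at most `r`, and `∞` otherwise. -/
noncomputable def truncDist (r : ℕ) (v w : V) : ℕ∞ :=
  if G.edist v w ≤ r then G.edist v w else ⊤

/-- The distance-`r` profile of `v` on `A`. -/
noncomputable def distProfile (r : ℕ) (v : V) (A : Set V) : Set (V × ℕ∞) :=
  {p | ∃ w ∈ A, p = (w, G.truncDist r v w)}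

/-- The distance-`r` diversity on `A`: the number of distinct distance-`r` profiles on `A` of
vertices outside `A`. -/
noncomputable def distDiversity (r : ℕ) (A : Set V) : ℕ :=
  {P | ∃ v, v ∉ A ∧ P = G.distProfile r v A}.ncard

end SimpleGraph

/-! Upper bound. The distance-1 profile of a vertex v outside A is determined by N(v) ∩ A. If N(v) ∩
A contains non-adjacent vertices x and y, contract v into x and keep only the new edge xy: at most
one neighbourhood is lost, and A gains a clique. Once all neighbourhoods are cliques, the cliques of
a minor on A count them (`card_image_neighbors_add_le`). So it suffices that a K_t-minor-free graph
on n vertices has at most cn + 1 cliques, where c = 3^(2t/3 + o(t)).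

Deleting vertices, or contracting edges whose ends have few cliques in their common neighbourhood,
reduces this to graphs on at most 2t² vertices (`card_cliquesIn_le_linear`). Branching on vertices
with many non-neighbours costs a factor 3^o(t) and leaves nearly complete graphs
(`card_cliquesIn_le_of_peel`). There, small connected dominating sets used as branch sets force n =
O(t log t) (`hasCliqueMinorOn_of_dense`). Then a maximum clique, of size w, extended by dominating
edges as two-vertex branch sets forces n + w ≤ 2t + o(t) (`hasCliqueMinorOn_of_pairs`). A Moon–Moser
type induction bounds the number of cliques by 3^((n + w)/3) (`card_cliquesIn_le_pow`).

Lower bound. The cocktail party graph on p pairs has n = 2p, w = p and exactly 3^p cliques. Attach a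
new vertex to each clique; since the new vertices are independent with cliques as neighbourhoods,
they do not help to build clique minors beyond the bounds 2t ≤ n + w or t ≤ w + 1
(`le_of_completeGraph_isMinorOf`). -/

namespace SimpleGraph

/-! ### Building complete minors in dense graphs -/

section Minors

open scoped Classical

variable {V : Type*} {G : SimpleGraph V}

/-- There is a model of the complete graph on `s` vertices in `G` all of whose branch sets lie in
`S`. -/
def HasCliqueMinorOn (G : SimpleGraph V) (S : Finset V) (s : ℕ) : Prop :=
  ∃ B : Fin s → Set V, (∀ i, B i ⊆ S) ∧ (∀ i, (G.induce (B i)).Connected) ∧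
    (∀ i j, i ≠ j → Disjoint (B i) (B j)) ∧
    ∀ i j, i ≠ j → ∃ x ∈ B i, ∃ y ∈ B j, G.Adj x y

theorem HasCliqueMinorOn.isMinorOf {S : Finset V} {s : ℕ} (h : HasCliqueMinorOn G S s) :
    (completeGraph (Fin s)).IsMinorOf G := by
  obtain ⟨B, -, hc, hd, ha⟩ := h
  exact ⟨B, hc, hd, fun v w hvw => ha v w (by simpa using hvw)⟩

theorem HasCliqueMinorOn.mono {S T : Finset V} {s : ℕ} (h : HasCliqueMinorOn G S s) (hST : S ⊆ T) :
    HasCliqueMinorOn G T s := by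
  obtain ⟨B, hS, h⟩ := h
  exact ⟨B, fun i => (hS i).trans (by exact_mod_cast hST), h⟩

theorem HasCliqueMinorOn.of_le {S : Finset V} {s r : ℕ} (h : HasCliqueMinorOn G S s) (hr : r ≤ s) :
    HasCliqueMinorOn G S r := by
  obtain ⟨B, hS, hc, hd, ha⟩ := h
  have hi : Function.Injective (Fin.castLE hr) := Fin.castLE_injective hr
  exact ⟨fun i => B (Fin.castLE hr i), fun i => hS _, fun i => hc _,
    fun i j hij => hd _ _ (hi.ne hij), fun i j hij => ha _ _ (hi.ne hij)⟩

/-- A connected dominating set can be added to a clique model outside of it. -/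
theorem HasCliqueMinorOn.succ {S T : Finset V} {s : ℕ} (hT : T ⊆ S)
    (hc : (G.induce (T : Set V)).Connected) (hdom : ∀ x ∈ S \ T, ∃ y ∈ T, G.Adj x y)
    (h : HasCliqueMinorOn G (S \ T) s) : HasCliqueMinorOn G S (s + 1) := by
  obtain ⟨B, hS, hBc, hBd, hBa⟩ := h
  have hTB : ∀ i, Disjoint (T : Set V) (B i) := fun i => by
    rw [Set.disjoint_left]
    intro x hx hxB
    have := hS i hxB
    simp at this hx
    exact this.2 hx
  have hex : ∀ i, ∃ x ∈ (T : Set V), ∃ y ∈ B i, G.Adj x y := fun i => by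
    obtain ⟨⟨x, hx⟩⟩ := (hBc i).nonempty
    obtain ⟨y, hy, hxy⟩ := hdom x (by simpa using hS i hx)
    exact ⟨y, hy, x, hx, hxy.symm⟩
  refine ⟨Fin.cons (T : Set V) B, fun i => ?_, fun i => ?_, fun i j => ?_, fun i j => ?_⟩
  · refine Fin.cases ?_ (fun i => ?_) i
    · exact_mod_cast hT
    · intro x hx
      have := hS i hx
      simp at this
      exact this.1
  · refine Fin.cases ?_ (fun i => ?_) i
    · exact hc
    · exact hBc i
  · refine Fin.cases ?_ (fun i => ?_) i <;> refine Fin.cases ?_ (fun j => ?_) j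
    · simp
    · intro _; exact hTB j
    · intro _; exact (hTB i).symm
    · intro hij; exact hBd i j (fun h => hij (by rw [h]))
  · refine Fin.cases ?_ (fun i => ?_) i <;> refine Fin.cases ?_ (fun j => ?_) j
    · simp
    · intro _; exact hex j
    · intro _
      obtain ⟨x, hx, y, hy, hxy⟩ := hex i
      exact ⟨y, hy, x, hx, hxy.symm⟩
    · intro hij; exact hBa i j (fun h => hij (by rw [h]))

theorem induce_connected_of_star {T : Finset V} {x : V} (hx : x ∈ T)
    (h : ∀ y ∈ T, y ≠ x → G.Adj x y) : (G.induce (T : Set V)).Connected := by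
  rw [connected_iff_exists_forall_reachable]
  refine ⟨⟨x, hx⟩, fun ⟨y, hy⟩ => ?_⟩
  by_cases hyx : y = x
  · subst hyx; exact Reachable.refl _
  · exact Adj.reachable (by simpa using h y hy hyx)

theorem hasCliqueMinorOn_of_isClique {K : Finset V} (hK : G.IsClique (K : Set V)) :
    HasCliqueMinorOn G K K.card := by
  induction K using Finset.induction_on with
  | empty => exact ⟨fun i => i.elim0, fun i => i.elim0, fun i => i.elim0, fun i => i.elim0,
      fun i => i.elim0⟩
  | insert a K ha ih =>
    rw [Finset.card_insert_of_notMem ha]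
    refine HasCliqueMinorOn.succ (T := {a}) (by simp) ?_ ?_ ?_
    · exact induce_connected_of_star (x := a) (by simp) (by simp)
    · intro x hx
      simp at hx
      exact ⟨a, by simp, hK (by simp [hx.1]) (by simp) hx.2⟩
    · have : insert a K \ {a} = K := by
        ext x; simp only [Finset.mem_sdiff, Finset.mem_insert, Finset.mem_singleton]
        constructor
        · rintro ⟨h | h, h'⟩ <;> tauto
        · intro h; exact ⟨Or.inr h, fun h' => ha (h' ▸ h)⟩
      rw [this]
      exact ih (hK.subset (by simp))

/-- If `G'` arises by contracting the edge `uv` of `G` to `u`, and possibly deleting edges, then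
clique models in `G'` lift to `G`. -/
theorem HasCliqueMinorOn.of_contract {G' : SimpleGraph V} {S : Finset V} {u v : V} {s : ℕ}
    (hv : v ∈ S) (huv : G.Adj u v)
    (hG' : ∀ x y, G'.Adj x y → G.Adj x y ∨ (x = u ∧ G.Adj v y) ∨ (y = u ∧ G.Adj v x))
    (h : HasCliqueMinorOn G' (S.erase v) s) : HasCliqueMinorOn G S s := by
  obtain ⟨B, hS, hc, hd, ha⟩ := h
  have hvB : ∀ i, v ∉ B i := fun i hi => by simpa using hS i hi
  let B' : Fin s → Set V := fun i => if u ∈ B i then insert v (B i) else B i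
  have hsub : ∀ i, B i ⊆ B' i := fun i => by
    simp only [B']; split_ifs
    · exact Set.subset_insert _ _
    · exact subset_rfl
  have hvm : ∀ i, u ∈ B i → v ∈ B' i := fun i hi => by simp [B', hi]
  have hmem : ∀ i x, x ∈ B' i → x ∈ B i ∨ (x = v ∧ u ∈ B i) := fun i x hx => by
    simp only [B'] at hx; split_ifs at hx with h
    · rcases hx with hx | hx
      · exact Or.inr ⟨hx, h⟩
      · exact Or.inl hx
    · exact Or.inl hx
  refine ⟨B', fun i x hx => ?_, fun i => ?_, fun i j hij => ?_, fun i j hij => ?_⟩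
  · rcases hmem i x hx with h | ⟨rfl, -⟩
    · have := hS i h
      simp at this
      exact this.1
    · exact hv
  · have key : ∀ x y (hx : x ∈ B i) (hy : y ∈ B i), G'.Adj x y →
        (G.induce (B' i)).Reachable ⟨x, hsub i hx⟩ ⟨y, hsub i hy⟩ := by
      intro x y hx hy hxy
      rcases hG' x y hxy with h | ⟨rfl, h⟩ | ⟨rfl, h⟩
      · exact Adj.reachable (by simpa using h)
      · have h1 : (G.induce (B' i)).Adj ⟨x, hsub i hx⟩ ⟨v, hvm i hx⟩ := by simpa using huv
        have h2 : (G.induce (B' i)).Adj ⟨v, hvm i hx⟩ ⟨y, hsub i hy⟩ := by simpa using h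
        exact h1.reachable.trans h2.reachable
      · have h1 : (G.induce (B' i)).Adj ⟨y, hsub i hy⟩ ⟨v, hvm i hy⟩ := by simpa using huv
        have h2 : (G.induce (B' i)).Adj ⟨v, hvm i hy⟩ ⟨x, hsub i hx⟩ := by simpa using h
        exact (h1.reachable.trans h2.reachable).symm
    have key2 : ∀ x y : B i, (G'.induce (B i)).Reachable x y →
        (G.induce (B' i)).Reachable ⟨x, hsub i x.2⟩ ⟨y, hsub i y.2⟩ := by
      rintro x y ⟨w⟩
      induction w with
      | nil => exact Reachable.refl _
      | cons h _ ih => exact (key _ _ (Subtype.prop _) (Subtype.prop _) (by simpa using h)).trans ih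
    rw [connected_iff_exists_forall_reachable]
    by_cases hu : u ∈ B i
    · refine ⟨⟨u, hsub i hu⟩, fun ⟨y, hy⟩ => ?_⟩
      rcases hmem i y hy with h | ⟨rfl, -⟩
      · exact key2 ⟨u, hu⟩ ⟨y, h⟩ ((hc i).preconnected _ _)
      · exact Adj.reachable (by simpa using huv)
    · obtain ⟨x⟩ := (hc i).nonempty
      refine ⟨⟨x, hsub i x.2⟩, fun ⟨y, hy⟩ => ?_⟩
      rcases hmem i y hy with h | ⟨-, h⟩
      · exact key2 x ⟨y, h⟩ ((hc i).preconnected _ _)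
      · exact absurd h hu
  · rw [Set.disjoint_left]
    have hij' := Set.disjoint_left.1 (hd i j hij)
    intro x hx hy
    rcases hmem i x hx with h | ⟨rfl, h⟩ <;> rcases hmem j x hy with h' | ⟨h1, h'⟩
    · exact hij' h h'
    · exact hvB i (h1 ▸ h)
    · exact hvB j h'
    · exact hij' h h'
  · obtain ⟨x, hx, y, hy, hxy⟩ := ha i j hij
    rcases hG' x y hxy with h | ⟨rfl, h⟩ | ⟨rfl, h⟩
    · exact ⟨x, hsub i hx, y, hsub j hy, h⟩
    · exact ⟨v, hvm i hx, y, hsub j hy, h⟩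
    · exact ⟨x, hsub i hx, v, hvm j hy, h.symm⟩

/-- Pairs with disjoint non-neighbourhoods, together with a clique, form a clique model. -/
theorem hasCliqueMinorOn_of_pairs {D : ℕ} {K : Finset V} (hK : G.IsClique (K : Set V)) (j : ℕ) :
    ∀ {S : Finset V}, K ⊆ S → (∀ v ∈ S, (S.filter fun x => ¬ G.Adj v x).card ≤ D) →
      2 * j + D ^ 2 + K.card ≤ S.card → HasCliqueMinorOn G S (K.card + j) := by
  induction j with
  | zero => exact fun hKS _ _ => (hasCliqueMinorOn_of_isClique hK).mono hKS
  | succ j ih =>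
    intro S hKS hD hcard
    have hSK : (S \ K).card = S.card - K.card := Finset.card_sdiff_of_subset hKS
    obtain ⟨a, ha⟩ : (S \ K).Nonempty := by rw [← Finset.card_pos]; omega
    have haS : a ∈ S := (Finset.mem_sdiff.1 ha).1
    -- A vertex outside `bad` shares no non-neighbour with `a`. Every vertex counts as its own
    -- non-neighbour, so `a` itself is bad and the chosen `b` is adjacent to `a`.
    let bad := (S.filter fun x => ¬ G.Adj a x).biUnion fun c => S.filter fun x => ¬ G.Adj c x
    have hbad : bad.card ≤ D ^ 2 := by
      calc bad.card ≤ (S.filter fun x => ¬ G.Adj a x).card * D :=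
            Finset.card_biUnion_le_card_mul _ _ _ fun c hc => hD c (Finset.mem_filter.1 hc).1
        _ ≤ D * D := Nat.mul_le_mul_right _ (hD a haS)
        _ = D ^ 2 := by ring
    obtain ⟨b, hb, hbb⟩ : ∃ b ∈ S \ K, b ∉ bad :=
      Finset.exists_mem_notMem_of_card_lt_card (by omega)
    have hbS : b ∈ S := (Finset.mem_sdiff.1 hb).1
    have hgood : ∀ c ∈ S, G.Adj a c ∨ G.Adj c b := by
      intro c hc
      by_contra! h
      exact hbb (Finset.mem_biUnion.2 ⟨c, by simp [hc, h.1], by simp [hbS, h.2]⟩)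
    have hab : G.Adj a b := by simpa using hgood a haS
    have hsub : ({a, b} : Finset V) ⊆ S := by
      intro x hx; simp at hx; rcases hx with rfl | rfl <;> assumption
    refine HasCliqueMinorOn.succ (s := K.card + j) (T := {a, b}) hsub ?_ ?_ (ih ?_ ?_ ?_)
    · refine induce_connected_of_star (x := a) (by simp) ?_
      intro y hy hya
      simp [hya] at hy
      exact hy ▸ hab
    · intro x hx
      rcases hgood x (Finset.mem_sdiff.1 hx).1 with h | h
      · exact ⟨a, by simp, h.symm⟩
      · exact ⟨b, by simp, h⟩
    · intro x hx
      simp only [Finset.mem_sdiff, Finset.mem_insert, Finset.mem_singleton, not_or] at ha hb ⊢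
      exact ⟨hKS hx, fun h => ha.2 (h ▸ hx), fun h => hb.2 (h ▸ hx)⟩
    · intro x hx
      exact (Finset.card_le_card (Finset.filter_subset_filter _ Finset.sdiff_subset)).trans
        (hD x (Finset.mem_sdiff.1 hx).1)
    · have h1 := Finset.card_sdiff_of_subset hsub
      have h2 : ({a, b} : Finset V).card ≤ 2 := Finset.card_le_two
      omega

/-- In a dense set there is a small star whose vertices miss only a few common vertices. -/
theorem exists_star_few_undominated {D : ℕ} {S : Finset V} (hS : S.Nonempty)
    (hD : ∀ v ∈ S, (S.filter fun x => ¬ G.Adj v x).card ≤ D) (hcard : 3 * D ≤ S.card) (k : ℕ) :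
    ∃ T ⊆ S, ∃ x ∈ T, (∀ y ∈ T, y ≠ x → G.Adj x y) ∧ T.card ≤ k + 1 ∧
      (S.filter fun c => ∀ y ∈ T, ¬ G.Adj c y).card * 2 ^ k ≤ S.card := by
  induction k with
  | zero =>
    obtain ⟨x, hx⟩ := hS
    refine ⟨{x}, by simpa using hx, x, by simp, by simp, by simp, ?_⟩
    simpa using Finset.card_filter_le _ _
  | succ k ih =>
    obtain ⟨T, hTS, x, hx, hstar, hT, hC⟩ := ih
    set C := S.filter fun c => ∀ y ∈ T, ¬ G.Adj c y with hCdef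
    let N := S.filter (G.Adj x)
    have hNc : 2 * D ≤ N.card := by
      have h1 := Finset.card_filter_add_card_filter_not (s := S) (G.Adj x)
      have h2 := hD x (hTS hx)
      simp only [N]; omega
    have hsum : ∑ y ∈ N, (C.filter fun c => ¬ G.Adj c y).card ≤ C.card * D := by
      have h1 : ∑ y ∈ N, (C.filter fun c => ¬ G.Adj c y).card
          = ∑ c ∈ C, (N.filter fun y => ¬ G.Adj c y).card :=
        (Finset.sum_card_bipartiteAbove_eq_sum_card_bipartiteBelow
          (s := C) (t := N) (fun c y => ¬ G.Adj c y)).symm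
      rw [h1]
      refine Finset.sum_le_card_nsmul _ _ _ fun c hc => ?_
      exact (Finset.card_le_card (Finset.filter_subset_filter _ (Finset.filter_subset _ _))).trans
        (hD c (Finset.mem_filter.1 hc).1)
    have hDpos : 0 < D := by
      refine lt_of_lt_of_le ?_ (hD x (hTS hx))
      exact Finset.card_pos.2 ⟨x, by simp [hTS hx]⟩
    -- Averaging: each undominated vertex misses at most `D` of the at least `2 * D` vertices of
    -- `N`, so some `y ∈ N` dominates at least half of `C`.
    obtain ⟨y, hy, hyC⟩ : ∃ y ∈ N, (C.filter fun c => ¬ G.Adj c y).card * 2 ≤ C.card := by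
      by_contra! h
      have h1 : ∑ y ∈ N, (C.card + 1) ≤ ∑ y ∈ N, (C.filter fun c => ¬ G.Adj c y).card * 2 :=
        Finset.sum_le_sum fun y hy => h y hy
      rw [← Finset.sum_mul, Finset.sum_const, smul_eq_mul] at h1
      nlinarith
    have hyS := (Finset.mem_filter.1 hy).1
    have hxy : G.Adj x y := (Finset.mem_filter.1 hy).2
    refine ⟨insert y T, Finset.insert_subset hyS hTS, x, by simp [hx], ?_, ?_, ?_⟩
    · intro z hz hzx
      rcases Finset.mem_insert.1 hz with rfl | hz
      · exact hxy
      · exact hstar z hz hzx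
    · exact (Finset.card_insert_le _ _).trans (by omega)
    · have : (S.filter fun c => ∀ z ∈ insert y T, ¬ G.Adj c z) = C.filter fun c => ¬ G.Adj c y := by
        ext c; simp [hCdef]; tauto
      rw [this, pow_succ]
      nlinarith [Nat.two_pow_pos k]

/-- Since `S.card < 2 ^ k`, `k` halvings leave no undominated vertex. So a star on at most `k + 1`
vertices dominates `S` and can serve as a branch set; the term `3 * D` keeps the set large enough to
extract `s` such stars in turn. -/
theorem hasCliqueMinorOn_of_dense {D k : ℕ} (s : ℕ) :
    ∀ {S : Finset V}, (∀ v ∈ S, (S.filter fun x => ¬ G.Adj v x).card ≤ D) → S.card < 2 ^ k →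
      3 * D + s * (k + 1) ≤ S.card → HasCliqueMinorOn G S s := by
  induction s with
  | zero =>
    exact fun _ _ _ => (hasCliqueMinorOn_of_isClique (K := ∅) (by simp)).mono (by simp)
  | succ s ih =>
    intro S hD hk hcard
    rw [Nat.succ_mul s (k + 1)] at hcard
    obtain ⟨T, hTS, x, hx, hstar, hT, hC⟩ := exists_star_few_undominated (S := S) (k := k)
      (by rw [← Finset.card_pos]; omega) hD (by omega)
    have hC0 : (S.filter fun c => ∀ y ∈ T, ¬ G.Adj c y) = ∅ := by
      rw [← Finset.card_eq_zero]
      by_contra h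
      have : 1 ≤ (S.filter fun c => ∀ y ∈ T, ¬ G.Adj c y).card := by omega
      nlinarith
    refine HasCliqueMinorOn.succ hTS (induce_connected_of_star hx hstar) ?_ (ih ?_ ?_ ?_)
    · intro c hc
      by_contra! h
      exact Finset.notMem_empty c (hC0 ▸ Finset.mem_filter.2 ⟨(Finset.mem_sdiff.1 hc).1, h⟩)
    · intro v hv
      exact (Finset.card_le_card (Finset.filter_subset_filter _ Finset.sdiff_subset)).trans
        (hD v (Finset.mem_sdiff.1 hv).1)
    · exact (Finset.card_le_card Finset.sdiff_subset).trans_lt hk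
    · have := Finset.card_sdiff_of_subset hTS
      omega

end Minors

/-! ### Counting cliques: recursion, clique number and contraction -/

section Cliques

open scoped Classical

variable {V : Type*}

/-- The cliques of `G` contained in `S`, including the empty one. -/
noncomputable def cliquesIn (G : SimpleGraph V) (S : Finset V) : Finset (Finset V) :=
  S.powerset.filter fun K => G.IsClique (K : Set V)

variable {G : SimpleGraph V}

theorem mem_cliquesIn {S K : Finset V} :
    K ∈ G.cliquesIn S ↔ K ⊆ S ∧ G.IsClique (K : Set V) := by
  simp [cliquesIn]

theorem empty_mem_cliquesIn (S : Finset V) : ∅ ∈ G.cliquesIn S := by simp [mem_cliquesIn]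

theorem card_cliquesIn_pos (S : Finset V) : 0 < (G.cliquesIn S).card :=
  Finset.card_pos.2 ⟨∅, empty_mem_cliquesIn S⟩

theorem card_cliquesIn_empty : (G.cliquesIn ∅).card = 1 := by
  simp [cliquesIn, Finset.filter_singleton]

theorem card_filter_mem_cliquesIn {S : Finset V} {v : V} (hv : v ∈ S) :
    ((G.cliquesIn S).filter fun K => v ∈ K).card = (G.cliquesIn (S.filter (G.Adj v))).card := by
  refine Finset.card_bij' (fun K _ => K.erase v) (fun K _ => insert v K) ?_ ?_ ?_ ?_
  · intro K hK
    rw [Finset.mem_filter, mem_cliquesIn] at hK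
    obtain ⟨⟨hKS, hc⟩, hvK⟩ := hK
    rw [mem_cliquesIn]
    refine ⟨fun x hx => ?_, hc.subset (by simp)⟩
    rw [Finset.mem_erase] at hx
    exact Finset.mem_filter.2 ⟨hKS hx.2, hc hvK hx.2 (Ne.symm hx.1)⟩
  · intro K hK
    rw [mem_cliquesIn] at hK
    obtain ⟨hKS, hc⟩ := hK
    rw [Finset.mem_filter, mem_cliquesIn]
    refine ⟨⟨Finset.insert_subset hv (hKS.trans (Finset.filter_subset _ _)), ?_⟩, by simp⟩
    rw [Finset.coe_insert]
    exact hc.insert fun b hb _ => (Finset.mem_filter.1 (hKS hb)).2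
  · intro K hK
    exact Finset.insert_erase (Finset.mem_filter.1 hK).2
  · intro K hK
    refine Finset.erase_insert fun h => ?_
    exact G.loopless.irrefl v (Finset.mem_filter.1 ((mem_cliquesIn.1 hK).1 h)).2

theorem card_cliquesIn_eq_add {S : Finset V} {v : V} (hv : v ∈ S) :
    (G.cliquesIn S).card
      = (G.cliquesIn (S.erase v)).card + (G.cliquesIn (S.filter (G.Adj v))).card := by
  rw [← card_filter_mem_cliquesIn hv,
    ← Finset.card_filter_add_card_filter_not (s := G.cliquesIn S) (fun K => v ∈ K), add_comm]
  congr 2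
  ext K
  simp only [Finset.mem_filter, mem_cliquesIn, Finset.subset_erase]
  tauto

/-- Double counting of pairs of a clique and a vertex in it; this feeds the averaging arguments of
`card_cliquesIn_le_linear`. -/
theorem sum_card_cliquesIn_filter (S : Finset V) :
    ∑ v ∈ S, (G.cliquesIn (S.filter (G.Adj v))).card = ∑ K ∈ G.cliquesIn S, K.card := by
  calc ∑ v ∈ S, (G.cliquesIn (S.filter (G.Adj v))).card
      = ∑ v ∈ S, ((G.cliquesIn S).filter fun K => v ∈ K).card :=
        Finset.sum_congr rfl fun v hv => (card_filter_mem_cliquesIn hv).symm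
    _ = ∑ K ∈ G.cliquesIn S, (S.filter fun v => v ∈ K).card :=
        Finset.sum_card_bipartiteAbove_eq_sum_card_bipartiteBelow (fun v K => v ∈ K)
    _ = ∑ K ∈ G.cliquesIn S, K.card := by
        refine Finset.sum_congr rfl fun K hK => ?_
        congr 1
        ext v
        simp only [Finset.mem_filter]
        exact ⟨fun h => h.2, fun h => ⟨(mem_cliquesIn.1 hK).1 h, h⟩⟩

theorem sum_card_le_of_card_le {S : Finset V} {w : ℕ} (h : ∀ K ∈ G.cliquesIn S, K.card ≤ w) :
    ∑ K ∈ G.cliquesIn S, K.card ≤ w * ((G.cliquesIn S).card - 1) := by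
  rw [← Finset.sum_erase (f := fun K : Finset V => K.card) (G.cliquesIn S) Finset.card_empty,
    ← Finset.card_erase_of_mem (empty_mem_cliquesIn S), mul_comm]
  exact Finset.sum_le_card_nsmul _ _ _ fun K hK => h K (Finset.mem_of_mem_erase hK)

/-- The clique number drops by one when passing to a set all of whose cliques extend by `v`. -/
theorem card_le_pred_of_adj {S T : Finset V} {v : V} {w : ℕ} (hv : v ∈ S) (hT : T ⊆ S)
    (hadj : ∀ x ∈ T, G.Adj v x) (hw : ∀ K ∈ G.cliquesIn S, K.card ≤ w) :
    ∀ K ∈ G.cliquesIn T, K.card ≤ w - 1 := by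
  intro K hK
  obtain ⟨hKT, hc⟩ := mem_cliquesIn.1 hK
  have hvK : v ∉ K := fun h => G.loopless.irrefl v (hadj v (hKT h))
  have := hw (insert v K) (mem_cliquesIn.2 ⟨Finset.insert_subset hv (hKT.trans hT), by
    rw [Finset.coe_insert]
    exact hc.insert fun b hb _ => hadj b (hKT hb)⟩)
  rw [Finset.card_insert_of_notMem hvK] at this
  omega

/-- A graph on `n` vertices with clique number `w` has at most `3 ^ ((n + w) / 3)` cliques. -/
theorem card_cliquesIn_le_pow {b : ℝ} (hb3 : 3 = b ^ 3) (hb2 : 2 ≤ b ^ 2) (hb1 : 4 / 3 ≤ b) (n : ℕ) :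
    ∀ {S : Finset V} {w : ℕ}, S.card = n → (∀ K ∈ G.cliquesIn S, K.card ≤ w) →
      ((G.cliquesIn S).card : ℝ) ≤ b ^ (S.card + w) := by
  have hb : 1 ≤ b := by linarith
  induction n using Nat.strong_induction_on with
  | _ n ih =>
  intro S w hS hw
  rcases S.eq_empty_or_nonempty with rfl | ⟨v₀, hv₀⟩
  · rw [card_cliquesIn_empty]
    exact_mod_cast one_le_pow₀ hb
  have hwpos : 1 ≤ w := by
    have := hw {v₀} (mem_cliquesIn.2 ⟨by simpa using hv₀, by simp⟩)
    simpa using this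
  -- Here `v` counts as its own non-neighbour. With two others, `n + w` falls by 1 on deleting `v`
  -- and by at least 4 on passing to its neighbourhood; given `b ^ 3 = 3`, the inequality `1 / b + 1
  -- / b ^ 4 ≤ 1` is `4 / 3 ≤ b`. Otherwise the complement is a matching: a vertex adjacent to all
  -- others doubles the count while `n + w` falls by 2, and a non-adjacent pair triples it while `n
  -- + w` falls by 3, the extremal case.
  by_cases hdeg : ∃ v ∈ S, 3 ≤ (S.filter fun x => ¬ G.Adj v x).card
  · obtain ⟨v, hv, hv3⟩ := hdeg
    have hN := Finset.card_filter_add_card_filter_not (s := S) (G.Adj v)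
    have he := Finset.card_erase_of_mem hv
    have hpos : 0 < S.card := Finset.card_pos.2 ⟨v, hv⟩
    have h1 := ih _ (by omega) (S := S.erase v) (w := w) he fun K hK =>
      hw K (mem_cliquesIn.2 ⟨(mem_cliquesIn.1 hK).1.trans (Finset.erase_subset _ _),
        (mem_cliquesIn.1 hK).2⟩)
    have h2 := ih _ (by omega) (S := S.filter (G.Adj v)) (w := w - 1) rfl
      (card_le_pred_of_adj hv (Finset.filter_subset _ _)
        (fun x hx => (Finset.mem_filter.1 hx).2) hw)
    have h3 : b ^ ((S.filter (G.Adj v)).card + (w - 1)) ≤ b ^ (S.card + w - 4) :=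
      pow_le_pow_right₀ hb (by omega)
    rw [card_cliquesIn_eq_add hv]
    push_cast
    have e1 : (S.erase v).card + w = (S.card + w - 4) + 3 := by omega
    have e2 : S.card + w = (S.card + w - 4) + 4 := by omega
    rw [e1, pow_add, ← hb3] at h1
    have e3 : b ^ (S.card + w) = b ^ (S.card + w - 4) * (3 * b) := by
      conv_lhs => rw [e2]
      rw [hb3]; ring
    rw [e3]
    have := pow_pos (show 0 < b by linarith) (S.card + w - 4)
    nlinarith
  · push Not at hdeg
    have hv₀' : v₀ ∈ S.filter fun x => ¬ G.Adj v₀ x := by simp [hv₀]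
    by_cases hiso : (S.filter fun x => ¬ G.Adj v₀ x) = {v₀}
    · have hadj : ∀ x ∈ S.erase v₀, G.Adj v₀ x := by
        intro x hx
        by_contra h
        have : x ∈ S.filter fun x => ¬ G.Adj v₀ x := by
          simp [h, Finset.mem_of_mem_erase hx]
        rw [hiso] at this
        exact (Finset.mem_erase.1 hx).1 (by simpa using this)
      have hfe : S.filter (G.Adj v₀) = S.erase v₀ := by
        ext x
        simp only [Finset.mem_filter]
        exact ⟨fun h => Finset.mem_erase.2 ⟨h.2.ne', h.1⟩,
          fun h => ⟨Finset.mem_of_mem_erase h, hadj x h⟩⟩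
      have he := Finset.card_erase_of_mem hv₀
      have hpos : 0 < S.card := Finset.card_pos.2 ⟨v₀, hv₀⟩
      have h1 := ih _ (by omega) (S := S.erase v₀) (w := w - 1) he
        (card_le_pred_of_adj hv₀ (Finset.erase_subset _ _) hadj hw)
      have e2 : S.card + w = ((S.erase v₀).card + (w - 1)) + 2 := by omega
      rw [card_cliquesIn_eq_add hv₀, hfe, e2, pow_add]
      push_cast
      have := pow_pos (show 0 < b by linarith) ((S.erase v₀).card + (w - 1))
      nlinarith
    · obtain ⟨u, hu, huv⟩ : ∃ u ∈ S.filter fun x => ¬ G.Adj v₀ x, u ≠ v₀ := by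
        by_contra! h
        exact hiso (Finset.eq_singleton_iff_unique_mem.2 ⟨hv₀', h⟩)
      obtain ⟨huS, huadj⟩ := Finset.mem_filter.1 hu
      have htwo : ∀ x y : V, x ∈ S → y ∈ S → y ≠ x → ¬ G.Adj x y →
          S.filter (G.Adj x) = (S.erase x).erase y := by
        intro x y hx hy hyx hxy
        have h2 : (S.filter fun z => ¬ G.Adj x z) = {x, y} := by
          symm
          refine Finset.eq_of_subset_of_card_le ?_ ?_
          · intro z hz
            simp only [Finset.mem_insert, Finset.mem_singleton] at hz
            rcases hz with rfl | rfl <;> simp [*]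
          · rw [Finset.card_pair hyx.symm]
            have := hdeg x hx
            omega
        ext z
        have h3 : z ∈ (S.filter fun z => ¬ G.Adj x z) ↔ z ∈ ({x, y} : Finset V) := by rw [h2]
        simp only [Finset.mem_filter, Finset.mem_insert, Finset.mem_singleton,
          Finset.mem_erase] at h3 ⊢
        constructor
        · rintro ⟨hz, hxz⟩
          refine ⟨?_, ?_, hz⟩ <;> · rintro rfl; simp_all
        · rintro ⟨hzy, hzx, hz⟩
          exact ⟨hz, by tauto⟩
      set R := (S.erase v₀).erase u with hR
      have hN1 : S.filter (G.Adj v₀) = R := htwo v₀ u hv₀ huS huv huadj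
      have hue : u ∈ S.erase v₀ := Finset.mem_erase.2 ⟨huv, huS⟩
      have hN2 : (S.erase v₀).filter (G.Adj u) = R := by
        rw [Finset.filter_erase, htwo u v₀ huS hv₀ huv.symm fun h => huadj h.symm, hR]
        ext z; simp only [Finset.mem_erase]; tauto
      have hcR : R.card + 2 = S.card := by
        have h1 : R.card + 1 = _ := Finset.card_erase_add_one hue
        have h2 := Finset.card_erase_add_one hv₀
        omega
      have h1 := ih _ (by omega) (S := R) (w := w - 1) rfl (hN1 ▸
        card_le_pred_of_adj hv₀ (Finset.filter_subset _ _)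
        (fun x hx => (Finset.mem_filter.1 hx).2) hw)
      have e2 : S.card + w = (R.card + (w - 1)) + 3 := by omega
      rw [card_cliquesIn_eq_add hv₀, hN1, card_cliquesIn_eq_add hue, hN2, e2, pow_add, ← hb3]
      push_cast
      linarith

/-- Contracting an edge `uv` to `u` loses at most two cliques for each clique in the common
neighbourhood of `u` and `v`. -/
theorem card_cliquesIn_le_contract {G' : SimpleGraph V} {S : Finset V} {u v : V}
    (hu : u ∈ S) (hv : v ∈ S) (huv : G.Adj v u) (hle : G ≤ G')
    (hG' : ∀ x, G.Adj v x → x ≠ u → G'.Adj u x) :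
    (G.cliquesIn S).card ≤ (G'.cliquesIn (S.erase v)).card
      + 2 * (G.cliquesIn ((S.filter (G.Adj v)).filter (G.Adj u))).card := by
  have huN : u ∈ S.filter (G.Adj v) := by simp [hu, huv]
  rw [card_cliquesIn_eq_add hv, card_cliquesIn_eq_add huN]
  -- Cliques containing `v` but not `u` correspond to `A`, and those containing both to `C`. A
  -- member of `A` outside `C` becomes, with `u` added, a clique of `G'` that is not one of `G`;
  -- only `C`, counted twice, is lost.
  set A := G.cliquesIn ((S.filter (G.Adj v)).erase u)
  set C := G.cliquesIn ((S.filter (G.Adj v)).filter (G.Adj u)) with hC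
  have hA : A.card ≤ (A \ C).card + C.card := Finset.card_le_card_sdiff_add_card
  have hunot : ∀ K ∈ A, u ∉ K := fun K hK h =>
    Finset.notMem_erase u _ ((mem_cliquesIn.1 hK).1 h)
  have hinj : Set.InjOn (insert u) ((A \ C : Finset (Finset V)) : Set (Finset V)) := by
    intro K hK L hL h
    simp only [Finset.coe_sdiff, Set.mem_sdiff, Finset.mem_coe] at hK hL
    rw [← Finset.erase_insert (hunot K hK.1), h, Finset.erase_insert (hunot L hL.1)]
  have hdisj : Disjoint (G.cliquesIn (S.erase v)) ((A \ C).image (insert u)) := by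
    rw [Finset.disjoint_left]
    intro K hK hK'
    obtain ⟨L, hL, rfl⟩ := Finset.mem_image.1 hK'
    obtain ⟨hLA, hLC⟩ := Finset.mem_sdiff.1 hL
    obtain ⟨hLs, hLc⟩ := mem_cliquesIn.1 hLA
    refine hLC (mem_cliquesIn.2 ⟨fun x hx => ?_, hLc⟩)
    have hx' := Finset.mem_erase.1 (hLs hx)
    exact Finset.mem_filter.2 ⟨hx'.2, (mem_cliquesIn.1 hK).2 (by simp) (by simp [hx]) hx'.1.symm⟩
  have hsub : G.cliquesIn (S.erase v) ∪ (A \ C).image (insert u) ⊆ G'.cliquesIn (S.erase v) := by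
    refine Finset.union_subset (fun K hK => ?_) (fun K hK => ?_)
    · exact mem_cliquesIn.2 ⟨(mem_cliquesIn.1 hK).1, (mem_cliquesIn.1 hK).2.mono hle⟩
    · obtain ⟨L, hL, rfl⟩ := Finset.mem_image.1 hK
      obtain ⟨hLs, hLc⟩ := mem_cliquesIn.1 (Finset.mem_sdiff.1 hL).1
      have hLadj : ∀ x ∈ L, x ≠ u ∧ x ∈ S ∧ G.Adj v x := fun x hx => by
        simpa using hLs hx
      refine mem_cliquesIn.2 ⟨Finset.insert_subset (Finset.mem_erase.2 ⟨huv.ne', hu⟩)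
        fun x hx => Finset.mem_erase.2 ⟨(hLadj x hx).2.2.ne', (hLadj x hx).2.1⟩, ?_⟩
      rw [Finset.coe_insert]
      exact (hLc.mono hle).insert fun x hx _ => hG' x (hLadj x hx).2.2 (hLadj x hx).1
  have := Finset.card_le_card hsub
  rw [Finset.card_union_of_disjoint hdisj, Finset.card_image_of_injOn hinj] at this
  omega

end Cliques

/-! ### From nearly complete graphs to all minor-free graphs, and from cliques to profiles -/

section CliqueBound

open scoped Classical

variable {V : Type*} {G : SimpleGraph V}

/-- If the subsets with few non-neighbours at every vertex have at most `M` cliques, then all sets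
have few cliques: repeatedly delete a vertex or pass to its neighbourhood. -/
theorem card_cliquesIn_le_of_peel {q a N : ℕ} {M : ℝ} (hq : 0 < q) (ha : 1 ≤ a) (hM : 0 ≤ M)
    (hqa : (1 - 1 / (q : ℝ)) ^ a * (N + 1) ≤ 1) (n : ℕ) :
    ∀ {S : Finset V}, S.card = n → n ≤ N →
      (∀ T ⊆ S, (∀ v ∈ T, q * (T.filter fun x => ¬ G.Adj v x).card ≤ T.card) →
        ((G.cliquesIn T).card : ℝ) ≤ M) →
      ((G.cliquesIn S).card : ℝ) ≤ M * (S.card + 1 : ℝ) ^ a := by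
  have hq' : (1 : ℝ) ≤ q := by exact_mod_cast hq
  have hq1 : 0 ≤ 1 - 1 / (q : ℝ) := by
    rw [sub_nonneg, div_le_one (by linarith)]; exact hq'
  induction n using Nat.strong_induction_on with
  | _ n ih =>
  intro S hS hN hdense
  by_cases h : ∀ v ∈ S, q * (S.filter fun x => ¬ G.Adj v x).card ≤ S.card
  · have h1 : (1 : ℝ) ≤ (S.card + 1 : ℝ) ^ a :=
      one_le_pow₀ (by have := Nat.cast_nonneg (α := ℝ) S.card; linarith)
    exact (hdense S subset_rfl h).trans (le_mul_of_one_le_right hM h1)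
  · push Not at h
    obtain ⟨v, hv, hqv⟩ := h
    have hsplit := Finset.card_filter_add_card_filter_not (s := S) (G.Adj v)
    have he := Finset.card_erase_add_one hv
    have hpos : 0 < (S.filter fun x => ¬ G.Adj v x).card :=
      Finset.card_pos.2 ⟨v, by simp [hv]⟩
    have h1 := ih _ (by omega) (S := S.erase v) rfl (by omega)
      fun T hT => hdense T (hT.trans (Finset.erase_subset _ _))
    have h2 := ih _ (by omega) (S := S.filter (G.Adj v)) rfl (by omega)
      fun T hT => hdense T (hT.trans (Finset.filter_subset _ _))
    rw [card_cliquesIn_eq_add hv]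
    push_cast
    set d := (S.filter (G.Adj v)).card
    set r := (S.filter fun x => ¬ G.Adj v x).card
    set m : ℝ := (S.card : ℝ) with hm
    have hm0 : 0 ≤ m := Nat.cast_nonneg _
    have hmN : m + 1 ≤ N + 1 := by rw [hm, hS]; exact_mod_cast Nat.succ_le_succ hN
    have hem : ((S.erase v).card : ℝ) + 1 = m := by rw [hm]; exact_mod_cast he
    rw [hem] at h1
    have hdr : (d : ℝ) + r = m := by rw [hm]; exact_mod_cast hsplit
    have hqr : m + 1 ≤ q * r := by rw [hm]; exact_mod_cast hqv
    have hd : (d : ℝ) + 1 ≤ (1 - 1 / (q : ℝ)) * (m + 1) := by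
      have : (m + 1) / q ≤ r := by rw [div_le_iff₀ (by linarith)]; linarith
      have e : (1 - 1 / (q : ℝ)) * (m + 1) = (m + 1) - (m + 1) / q := by ring
      rw [e]; linarith
    have hX : (0 : ℝ) < (m + 1) ^ a := by positivity
    -- After multiplication by `m + 1`, deletion of `v` accounts for `m` of the `m + 1` copies of
    -- `(m + 1) ^ a`, and passing to the neighbourhood for the remaining one. The latter is where
    -- `hqa` enters.
    have b1 : m ^ a * (m + 1) ≤ (m + 1) ^ a * m := by
      obtain ⟨k, rfl⟩ := Nat.exists_eq_add_of_le' ha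
      rw [pow_succ, pow_succ]
      have : m ^ k ≤ (m + 1) ^ k := pow_le_pow_left₀ hm0 (by linarith) k
      have := mul_le_mul_of_nonneg_right this (show 0 ≤ m * (m + 1) by positivity)
      nlinarith
    have b2 : ((d : ℝ) + 1) ^ a * (m + 1) ≤ (m + 1) ^ a := by
      calc ((d : ℝ) + 1) ^ a * (m + 1)
          ≤ ((1 - 1 / (q : ℝ)) * (m + 1)) ^ a * (N + 1) := by gcongr
        _ = (m + 1) ^ a * ((1 - 1 / (q : ℝ)) ^ a * (N + 1)) := by rw [mul_pow]; ring
        _ ≤ (m + 1) ^ a * 1 := by gcongr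
        _ = _ := mul_one _
    have b3 : m ^ a + ((d : ℝ) + 1) ^ a ≤ (m + 1) ^ a := by
      by_contra hcon
      push Not at hcon
      have := mul_lt_mul_of_pos_right hcon (show (0 : ℝ) < m + 1 by linarith)
      nlinarith
    calc ((G.cliquesIn (S.erase v)).card : ℝ) + ((G.cliquesIn (S.filter (G.Adj v))).card : ℝ)
        ≤ M * m ^ a + M * ((d : ℝ) + 1) ^ a := add_le_add h1 h2
      _ = M * (m ^ a + ((d : ℝ) + 1) ^ a) := by ring
      _ ≤ M * (m + 1) ^ a := mul_le_mul_of_nonneg_left b3 hM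

/-- With `D = S.card / q`, the dominating stars give `S.card ≤ 2 * t * (k + 1)`, hence a bound on
`D`. The pairs then give `S.card + K.card ≤ 2 * t + D ^ 2` for a maximum clique `K`, which bounds
the exponent in `card_cliquesIn_le_pow`. The condition `6 ≤ q` lets `3 * D` take up at most half of
`S`. -/
theorem card_cliquesIn_le_of_dense {b : ℝ} (hb3 : 3 = b ^ 3) (hb2 : 2 ≤ b ^ 2) (hb1 : 4 / 3 ≤ b)
    {t q k : ℕ} (hq : 6 ≤ q) {S : Finset V} (hS : ¬ HasCliqueMinorOn G S t) (hk : S.card < 2 ^ k)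
    (hdeg : ∀ v ∈ S, q * (S.filter fun x => ¬ G.Adj v x).card ≤ S.card) :
    ((G.cliquesIn S).card : ℝ) ≤ b ^ (2 * t + (2 * t * (k + 1) / q) ^ 2) := by
  have hD : ∀ v ∈ S, (S.filter fun x => ¬ G.Adj v x).card ≤ S.card / q := fun v hv => by
    rw [Nat.le_div_iff_mul_le (by omega), mul_comm]; exact hdeg v hv
  have hDS : 6 * (S.card / q) ≤ S.card :=
    (Nat.mul_le_mul_right _ hq).trans (Nat.mul_div_le _ _)
  have hsmall : S.card ≤ 2 * t * (k + 1) := by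
    by_contra h
    refine hS (hasCliqueMinorOn_of_dense t hD hk ?_)
    rw [mul_assoc] at h
    omega
  obtain ⟨K, hK, hmax⟩ := (G.cliquesIn S).exists_max_image Finset.card ⟨∅, empty_mem_cliquesIn S⟩
  obtain ⟨hKS, hKc⟩ := mem_cliquesIn.1 hK
  have hKt : K.card < t := by
    by_contra h
    exact hS (((hasCliqueMinorOn_of_isClique hKc).mono hKS).of_le (by omega))
  have hle : S.card + K.card ≤ 2 * t + (S.card / q) ^ 2 := by
    by_contra h
    refine hS ((hasCliqueMinorOn_of_pairs hKc (t - K.card) hKS hD ?_).of_le (by omega))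
    omega
  refine (card_cliquesIn_le_pow hb3 hb2 hb1 _ rfl hmax).trans
    (pow_le_pow_right₀ (by linarith) (hle.trans ?_))
  gcongr

/-- A bound on the number of cliques in small `K_t`-minor-free graphs gives a linear bound on the
number of cliques in all `K_t`-minor-free graphs. -/
theorem card_cliquesIn_le_linear {t c : ℕ} (ht : 0 < t)
    (hc : ∀ (G : SimpleGraph V) (S : Finset V), ¬ HasCliqueMinorOn G S t → S.card ≤ 2 * t ^ 2 →
      (G.cliquesIn S).card ≤ c) (n : ℕ) :
    ∀ (G : SimpleGraph V) (S : Finset V), S.card = n → ¬ HasCliqueMinorOn G S t →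
      (G.cliquesIn S).card ≤ c * S.card + 1 := by
  induction n with
  | zero =>
    intro G S hS _
    rw [Finset.card_eq_zero] at hS
    subst hS
    simp [card_cliquesIn_empty]
  | succ n ih =>
    intro G S hS hm
    have hclique : ∀ T ⊆ S, ∀ K ∈ G.cliquesIn T, K.card ≤ t := by
      intro T hT K hK
      obtain ⟨hKT, hKc⟩ := mem_cliquesIn.1 hK
      by_contra h
      exact hm (((hasCliqueMinorOn_of_isClique hKc).mono (hKT.trans hT)).of_le (by omega))
    obtain ⟨v, hv, hmin⟩ := S.exists_min_image
      (fun v => (G.cliquesIn (S.filter (G.Adj v))).card) (Finset.card_pos.1 (by omega))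
    have he := Finset.card_erase_add_one hv
    by_cases hdeg : (S.filter (G.Adj v)).card ≤ 2 * t ^ 2
    · have h1 := ih G (S.erase v) (by omega) fun h => hm (h.mono (Finset.erase_subset _ _))
      have h2 := hc G (S.filter (G.Adj v)) (fun h => hm (h.mono (Finset.filter_subset _ _))) hdeg
      rw [card_cliquesIn_eq_add hv, ← he]
      nlinarith
    · set T := S.filter (G.Adj v) with hT
      have hTS : T ⊆ S := Finset.filter_subset _ _
      set p := (G.cliquesIn T).card
      -- Averaging: cliques in `T` have at most `t` vertices, so the counts over `u ∈ T` sum to at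
      -- most `t * p`, while `T` has more than `2 * t ^ 2` vertices.
      obtain ⟨u, hu, hup⟩ : ∃ u ∈ T, 2 * t * (G.cliquesIn (T.filter (G.Adj u))).card ≤ p := by
        by_contra! h
        have h1 : ∑ u ∈ T, p ≤ ∑ u ∈ T, 2 * t * (G.cliquesIn (T.filter (G.Adj u))).card :=
          Finset.sum_le_sum fun u hu => (h u hu).le
        rw [← Finset.mul_sum, sum_card_cliquesIn_filter, Finset.sum_const, smul_eq_mul] at h1
        have h2 := sum_card_le_of_card_le (hclique T hTS)
        have h3 : 0 < p := card_cliquesIn_pos _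
        have h4 : t * ((G.cliquesIn T).card - 1) ≤ t * p := Nat.mul_le_mul_left _ (Nat.sub_le _ _)
        have h5 : 2 * t * ∑ K ∈ G.cliquesIn T, K.card ≤ 2 * t * (t * p) :=
          Nat.mul_le_mul_left _ (h2.trans h4)
        have h6 : 2 * t ^ 2 * p < T.card * p := Nat.mul_lt_mul_of_pos_right (by omega) h3
        nlinarith
      obtain ⟨huS, hvu⟩ := Finset.mem_filter.1 hu
      have hcon := card_cliquesIn_le_contract (G := G)
        (G' := G ⊔ fromRel fun x y => x = u ∧ G.Adj v y) huS hv hvu le_sup_left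
        fun x hx hxu => Or.inr ⟨hxu.symm, Or.inl ⟨rfl, hx⟩⟩
      rw [← hT] at hcon
      have h1 := ih (G ⊔ fromRel fun x y => x = u ∧ G.Adj v y) (S.erase v) (by omega) fun h =>
        hm (h.of_contract hv hvu.symm fun x y hxy => by
          rcases hxy with hxy | ⟨-, hxy⟩
          · exact Or.inl hxy
          · exact Or.inr hxy)
      have hcn : (S.erase v).card = n := by omega
      rw [hcn] at h1
      set x := (G.cliquesIn (T.filter (G.Adj u))).card
      -- By the choice of `v`, every vertex lies in at least `p` cliques, and each non-empty clique
      -- has at most `t` vertices.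
      have hnp : (n + 1) * p ≤ t * ((G.cliquesIn S).card - 1) := by
        rw [← hS]
        calc S.card * p = ∑ _w ∈ S, p := by simp
          _ ≤ _ := Finset.sum_le_sum hmin
          _ = _ := sum_card_cliquesIn_filter S
          _ ≤ _ := sum_card_le_of_card_le (hclique S subset_rfl)
      obtain ⟨f, hf⟩ : ∃ f, (G.cliquesIn S).card = f + 1 :=
        ⟨_, (Nat.succ_pred_eq_of_pos (card_cliquesIn_pos S)).symm⟩
      rw [hf, Nat.add_sub_cancel] at hnp
      rw [hf] at hcon
      rw [hf, hS, Nat.add_le_add_iff_right]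
      have hn : 0 < n := by
        have := Finset.card_le_card hTS
        have : 1 ≤ t ^ 2 := Nat.one_le_pow _ _ ht
        omega
      have hxf : 2 * (n + 1) * x ≤ f := by
        refine Nat.le_of_mul_le_mul_left (le_trans ?_ hnp) ht
        calc t * (2 * (n + 1) * x) = (n + 1) * (2 * t * x) := by ring
          _ ≤ _ := Nat.mul_le_mul_left _ hup
      have hfx : f ≤ c * n + 2 * x := by omega
      -- Multiplying `hfx` by `n + 1` and using `hxf` gives `(n + 1) * f ≤ (n + 1) * c * n + f`, so
      -- the contraction losses accumulate no error.
      refine Nat.le_of_mul_le_mul_left (?_ : n * f ≤ n * (c * (n + 1))) hn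
      nlinarith

/-- Neighbourhoods in `A` of vertices in `W` are turned into cliques of a minor on `A`. -/
theorem card_image_neighbors_add_le {t c : ℕ}
    (hc : ∀ (G : SimpleGraph V) (S : Finset V), ¬ HasCliqueMinorOn G S t →
      (G.cliquesIn S).card ≤ c * S.card + 1) (A : Finset V) (n : ℕ) :
    ∀ (G : SimpleGraph V) (W : Finset V), W.card = n → Disjoint A W →
      ¬ HasCliqueMinorOn G (A ∪ W) t →
      (W.image fun v => A.filter (G.Adj v)).card + (G.cliquesIn A).card ≤ 2 * (c * A.card + 1) := by
  induction n with
  | zero =>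
    intro G W hW _ hm
    have := hc G A fun h => hm (h.mono Finset.subset_union_left)
    rw [Finset.card_eq_zero] at hW
    subst hW
    simp
    omega
  | succ n ih =>
    intro G W hW hAW hm
    by_cases hcl : ∀ v ∈ W, G.IsClique (A.filter (G.Adj v) : Set V)
    · have h1 := hc G A fun h => hm (h.mono Finset.subset_union_left)
      have h2 : (W.image fun v => A.filter (G.Adj v)) ⊆ G.cliquesIn A := by
        intro K hK
        obtain ⟨v, hv, rfl⟩ := Finset.mem_image.1 hK
        exact mem_cliquesIn.2 ⟨Finset.filter_subset _ _, hcl v hv⟩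
      have := Finset.card_le_card h2
      omega
    · push Not at hcl
      obtain ⟨v, hv, hncl⟩ := hcl
      simp only [IsClique, Set.Pairwise] at hncl
      push Not at hncl
      obtain ⟨x, hx, y, hy, hxy, hnadj⟩ := hncl
      simp only [Finset.coe_filter, Set.mem_ofPred_eq] at hx hy
      have hvA : v ∉ A := Finset.disjoint_right.1 hAW hv
      have hunion : (A ∪ W).erase v = A ∪ W.erase v := by
        rw [Finset.erase_union_distrib, Finset.erase_eq_of_notMem hvA]
      -- The full contraction could create more edges. Adding only `xy`, inside `A`, leaves the
      -- neighbourhoods in `A` of all other vertices of `W` unchanged.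
      obtain ⟨G', hle, hadj⟩ : ∃ G', G ≤ G' ∧ ∀ a b, G'.Adj a b ↔ G.Adj a b ∨ (edge x y).Adj a b :=
        ⟨G ⊔ edge x y, le_sup_left, fun a b => sup_adj _ _ _ _⟩
      have h1 := ih G' (W.erase v) (by have := Finset.card_erase_add_one hv; omega)
        (hAW.mono_right (Finset.erase_subset _ _)) fun h =>
          hm (HasCliqueMinorOn.of_contract (v := v) (u := x) (by simp [hv]) hx.2.symm (fun a b hab => by
            rcases (hadj a b).1 hab with hab | hab
            · exact Or.inl hab
            · rw [edge_adj] at hab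
              rcases hab.1 with ⟨rfl, rfl⟩ | ⟨rfl, rfl⟩
              · exact Or.inr (Or.inl ⟨rfl, hy.2⟩)
              · exact Or.inr (Or.inr ⟨rfl, hy.2⟩)) (hunion ▸ h))
      have h2 : (W.image fun v => A.filter (G.Adj v)) ⊆ insert (A.filter (G.Adj v))
          ((W.erase v).image fun v => A.filter (G'.Adj v)) := by
        intro K hK
        obtain ⟨w, hw, rfl⟩ := Finset.mem_image.1 hK
        by_cases hwv : w = v
        · simp [hwv]
        · refine Finset.mem_insert_of_mem (Finset.mem_image.2
            ⟨w, Finset.mem_erase.2 ⟨hwv, hw⟩, ?_⟩)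
          refine Finset.filter_congr fun z _ => ?_
          have hwA : w ∉ A := Finset.disjoint_right.1 hAW hw
          have hwx : w ≠ x := fun h => hwA (h ▸ hx.1)
          have hwy : w ≠ y := fun h => hwA (h ▸ hy.1)
          simp [hadj, edge_adj, hwx, hwy]
      have h3 : (G.cliquesIn A).card < (G'.cliquesIn A).card := by
        refine Finset.card_lt_card (Finset.ssubset_iff_of_subset ?_ |>.2 ⟨{x, y}, ?_, ?_⟩)
        · exact fun K hK => mem_cliquesIn.2
            ⟨(mem_cliquesIn.1 hK).1, (mem_cliquesIn.1 hK).2.mono hle⟩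
        · refine mem_cliquesIn.2 ⟨?_, ?_⟩
          · intro z hz
            simp only [Finset.mem_insert, Finset.mem_singleton] at hz
            rcases hz with rfl | rfl
            exacts [hx.1, hy.1]
          · rw [Finset.coe_pair, isClique_pair]
            exact fun _ => (hadj x y).2 (Or.inr (by simp [edge_adj, hxy]))
        · intro h
          have := (mem_cliquesIn.1 h).2
          rw [Finset.coe_pair, isClique_pair] at this
          exact hnadj (this hxy)
      have h4 := (Finset.card_le_card h2).trans (Finset.card_insert_le _ _)
      omega

theorem truncDist_one_of_ne {v w : V} (h : v ≠ w) :
    G.truncDist 1 v w = if G.Adj v w then 1 else ⊤ := by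
  unfold truncDist
  split_ifs with h1 h2 h2
  · exact edist_eq_one_iff_adj.2 h2
  · rw [Nat.cast_one, Order.le_one_iff] at h1
    rcases h1 with h1 | h1
    · exact absurd (edist_eq_zero_iff.1 h1) h
    · exact absurd (edist_eq_one_iff_adj.1 h1) h2
  · exact absurd (edist_eq_one_iff_adj.2 h2).le h1
  · rfl

theorem distDiversity_one_le_card [Fintype V] (A : Set V) :
    G.distDiversity 1 A ≤ ((A.toFinset)ᶜ.image fun v => A.toFinset.filter (G.Adj v)).card := by
  rw [← Set.ncard_coe_finset]
  refine le_trans (Set.ncard_le_ncard ?_ (Set.toFinite _)) (Set.ncard_image_le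
    (f := fun F : Finset V => {p : V × ℕ∞ | ∃ w ∈ A, p = (w, if w ∈ F then 1 else ⊤)})
    (Set.toFinite _))
  rintro P ⟨v, hv, rfl⟩
  refine ⟨A.toFinset.filter (G.Adj v), by
    rw [Finset.mem_coe]
    exact Finset.mem_image_of_mem (fun v => A.toFinset.filter (G.Adj v)) (by simpa using hv), ?_⟩
  ext p
  simp only [distProfile, Set.mem_ofPred_eq]
  refine exists_congr fun w => and_congr_right fun hw => ?_
  have hvw : v ≠ w := fun h => hv (h ▸ hw)
  rw [truncDist_one_of_ne hvw]
  simp [hw]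

end CliqueBound

/-! ### Choice of parameters and the upper bound -/

section UpperBound

/-- The relative density of non-neighbours at which the peeling process stops. -/
noncomputable def peelRatio (t : ℕ) : ℕ := ⌈(t : ℝ) ^ (3 / 4 : ℝ)⌉₊ + 6

/-- The exponent of the polynomial loss in the peeling process. -/
noncomputable def peelExponent (t : ℕ) : ℕ := ⌈(peelRatio t : ℝ) * Real.log (2 * t ^ 2 + 1)⌉₊ + 1

/-- The number of non-neighbours of a vertex when the peeling process stops. -/
noncomputable def peelCodegree (t : ℕ) : ℕ := 2 * t * (Nat.log 2 (2 * t ^ 2) + 1 + 1) / peelRatio t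

/-- The error term in the exponent of the bound on the distance-`1` diversity. -/
noncomputable def diversityError (t : ℕ) : ℝ :=
  Real.logb 3 2 + (peelCodegree t : ℝ) ^ 2 / 3 + peelExponent t * Real.logb 3 (2 * t ^ 2 + 1)

/-- From `1 - 1 / q ≤ exp (-1 / q)`: the exponent is at least `q * log (2 * t ^ 2 + 1)`. This is the
hypothesis `hqa` of the peeling lemma. -/
theorem peel_pow_mul_le_one (t : ℕ) :
    (1 - 1 / (peelRatio t : ℝ)) ^ peelExponent t * ((2 * t ^ 2 : ℕ) + 1) ≤ 1 := by
  have hq : (1 : ℝ) ≤ peelRatio t := by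
    have : 1 ≤ peelRatio t := by unfold peelRatio; omega
    exact_mod_cast this
  have hq0 : (0 : ℝ) < peelRatio t := by linarith
  have hN : (0 : ℝ) < 2 * t ^ 2 + 1 := by positivity
  have h1 : (1 - 1 / (peelRatio t : ℝ)) ^ peelExponent t
      ≤ Real.exp (-Real.log (2 * t ^ 2 + 1)) := by
    calc (1 - 1 / (peelRatio t : ℝ)) ^ peelExponent t
        ≤ Real.exp (-(1 / (peelRatio t : ℝ))) ^ peelExponent t := by
          refine pow_le_pow_left₀ ?_ (Real.one_sub_le_exp_neg _) _
          rw [sub_nonneg, div_le_one hq0]; exact hq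
      _ = Real.exp (-((peelExponent t : ℝ) / peelRatio t)) := by
          rw [← Real.exp_nat_mul]; ring_nf
      _ ≤ _ := by
          rw [Real.exp_le_exp, neg_le_neg_iff, le_div_iff₀ hq0, mul_comm]
          unfold peelExponent
          push_cast
          exact (Nat.le_ceil _).trans (by linarith)
  rw [Real.exp_neg, Real.exp_log hN] at h1
  push_cast
  calc (1 - 1 / (peelRatio t : ℝ)) ^ peelExponent t * (2 * (t : ℝ) ^ 2 + 1)
        ≤ (2 * (t : ℝ) ^ 2 + 1)⁻¹ * (2 * (t : ℝ) ^ 2 + 1) := by gcongr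
    _ = 1 := inv_mul_cancel₀ hN.ne'

/-- With q of order t^(3/4), the codegree is O(t^(1/4) log t), so its square is o(t), and the
polynomial loss contributes O(t^(3/4) log² t) to the exponent. Any q well above √t log t and well
below t / log² t would do. -/
theorem diversityError_isLittleO : diversityError =o[atTop] fun t : ℕ => (t : ℝ) := by
  have h1 : diversityError =O[atTop]
      fun t : ℕ => (t : ℝ) ^ (3 / 4 : ℝ) * Real.log t ^ (2 : ℝ) := by
    refine IsBigO.of_bound 500 ?_
    filter_upwards [eventually_ge_atTop 3] with t ht
    have ht' : (3 : ℝ) ≤ t := by exact_mod_cast ht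
    have ht0 : (0 : ℝ) < t := by linarith
    set x := (t : ℝ) ^ (3 / 4 : ℝ) with hx
    set y := (t : ℝ) ^ (1 / 4 : ℝ) with hy
    have hxy : x * y = t := by
      rw [hx, hy, ← Real.rpow_add ht0]; norm_num
    have hyx : y ^ 2 ≤ x := by
      rw [hx, hy, ← Real.rpow_natCast, ← Real.rpow_mul ht0.le]
      exact Real.rpow_le_rpow_of_exponent_le (by linarith) (by norm_num)
    have hx1 : 1 ≤ x := Real.one_le_rpow (by linarith) (by norm_num)
    have hy1 : 1 ≤ y := Real.one_le_rpow (by linarith) (by norm_num)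
    set l := Real.log t with hl
    have h3 : 1 ≤ Real.log 3 := by
      rw [Real.le_log_iff_exp_le (by norm_num)]
      exact Real.exp_one_lt_d9.le.trans (by norm_num)
    have hl1 : 1 ≤ l := h3.trans (Real.log_le_log (by norm_num) ht')
    have hlogN : Real.log (2 * t ^ 2 + 1) ≤ 4 * l := by
      have : (4 : ℝ) * l = Real.log ((t : ℝ) ^ 4) := by rw [Real.log_pow, hl]; norm_num
      rw [this]
      refine Real.log_le_log (by positivity) ?_
      nlinarith [sq_nonneg ((t : ℝ) ^ 2 - 9)]
    have hlogN0 : 0 ≤ Real.log (2 * t ^ 2 + 1) := Real.log_nonneg (by nlinarith)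
    have hlogb : Real.logb 3 (2 * t ^ 2 + 1) ≤ 4 * l := (div_le_self hlogN0 h3).trans hlogN
    have hlogb0 : 0 ≤ Real.logb 3 (2 * t ^ 2 + 1) := div_nonneg hlogN0 (by linarith)
    have hk : ((Nat.log 2 (2 * t ^ 2) : ℕ) : ℝ) ≤ 8 * l := by
      have e1 := Real.natLog_le_logb (2 * t ^ 2) 2
      refine e1.trans ?_
      have h2 : (0.5 : ℝ) ≤ Real.log 2 := by have := Real.log_two_gt_d9; linarith
      rw [Real.logb]
      push_cast
      rw [div_le_iff₀ (by linarith)]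
      have : Real.log (2 * (t : ℝ) ^ 2) ≤ 4 * l :=
        (Real.log_le_log (by positivity) (by linarith)).trans hlogN
      nlinarith
    have hqx : x ≤ peelRatio t := by
      unfold peelRatio; push_cast
      exact (Nat.le_ceil _).trans (by linarith)
    have hqx' : (peelRatio t : ℝ) ≤ 8 * x := by
      unfold peelRatio; push_cast
      have := (Nat.ceil_lt_add_one (by linarith : 0 ≤ x)).le
      rw [hx] at this ⊢
      linarith
    have hD : (peelCodegree t : ℝ) ≤ 20 * (y * l) := by
      refine (Nat.cast_div_le).trans ?_
      rw [div_le_iff₀ (by linarith)]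
      push_cast
      calc 2 * (t : ℝ) * ((Nat.log 2 (2 * t ^ 2) : ℕ) + 1 + 1) ≤ 2 * t * (10 * l) := by
            gcongr; linarith
        _ = 20 * (y * l) * x := by rw [← hxy]; ring
        _ ≤ _ := by gcongr
    have hD2 : (peelCodegree t : ℝ) ^ 2 ≤ 400 * (x * l ^ 2) := by
      calc (peelCodegree t : ℝ) ^ 2 ≤ (20 * (y * l)) ^ 2 := by gcongr
        _ = 400 * (y ^ 2 * l ^ 2) := by ring
        _ ≤ _ := by gcongr
    have ha : (peelExponent t : ℝ) ≤ 34 * (x * l) := by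
      unfold peelExponent; push_cast
      have e1 := (Nat.ceil_lt_add_one
        (mul_nonneg (Nat.cast_nonneg (peelRatio t)) hlogN0)).le
      have e2 : (peelRatio t : ℝ) * Real.log (2 * t ^ 2 + 1) ≤ 8 * x * (4 * l) := by gcongr
      nlinarith
    have ha2 : (peelExponent t : ℝ) * Real.logb 3 (2 * t ^ 2 + 1) ≤ 136 * (x * l ^ 2) := by
      calc _ ≤ 34 * (x * l) * (4 * l) := by gcongr
        _ = _ := by ring
    have hb : Real.logb 3 2 ≤ 1 := by
      rw [Real.logb_le_iff_le_rpow (by norm_num) (by norm_num)]; norm_num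
    have hb0 : 0 ≤ Real.logb 3 2 := Real.logb_nonneg (by norm_num) (by norm_num)
    have hxl : 1 ≤ x * l ^ 2 := one_le_mul_of_one_le_of_one_le hx1 (one_le_pow₀ hl1)
    have hnn : 0 ≤ diversityError t := by unfold diversityError; positivity
    rw [Real.norm_of_nonneg hnn, Real.rpow_two, Real.norm_of_nonneg (by linarith)]
    unfold diversityError
    linarith
  have h2 : (fun t : ℕ => (t : ℝ) ^ (3 / 4 : ℝ) * Real.log t ^ (2 : ℝ)) =o[atTop]
      fun t : ℕ => (t : ℝ) ^ (3 / 4 : ℝ) * (t : ℝ) ^ (1 / 4 : ℝ) :=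
    (isBigO_refl _ _).mul_isLittleO
      ((isLittleO_log_rpow_rpow_atTop 2 (by norm_num : (0 : ℝ) < 1 / 4)).comp_tendsto
        tendsto_natCast_atTop_atTop)
  refine (h1.trans_isLittleO h2).congr' EventuallyEq.rfl ?_
  filter_upwards [eventually_gt_atTop 0] with t ht
  rw [← Real.rpow_add (by exact_mod_cast ht)]
  norm_num

theorem distDiversity_one_le {t : ℕ} {V : Type*} [Finite V] {G : SimpleGraph V}
    (hG : G.CompleteMinorFree t) (A : Set V) :
    (G.distDiversity 1 A : ℝ)
      ≤ (3 : ℝ) ^ (2 * (t : ℝ) / 3 + diversityError t) * (A.ncard : ℝ) + 1 := by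
  classical
  have := Fintype.ofFinite V
  -- The empty complete graph is a minor of every graph, so `t = 0` is vacuous.
  rcases Nat.eq_zero_or_pos t with rfl | ht
  · exact absurd ⟨fun i => i.elim0, fun i => i.elim0, fun i => i.elim0, fun i => i.elim0⟩ hG
  set b : ℝ := (3 : ℝ) ^ (1 / 3 : ℝ) with hb
  have hb0 : 0 < b := by positivity
  have hb3 : 3 = b ^ 3 := by
    rw [hb, ← Real.rpow_natCast, ← Real.rpow_mul (by norm_num)]; norm_num
  -- The value 1.42 lies between the square root of 2 and the cube root of 3, so it yields both `2 ≤
  -- b ^ 2` and `4 / 3 ≤ b`.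
  have hb1 : 1.42 ≤ b := by
    by_contra! h
    have : b ^ 3 < 1.42 ^ 3 := pow_lt_pow_left₀ h hb0.le (by norm_num)
    norm_num [← hb3] at this
  have hb2 : 2 ≤ b ^ 2 := by nlinarith
  set M : ℝ := b ^ (2 * t + peelCodegree t ^ 2) with hM
  set a := peelExponent t
  have hM0 : 0 ≤ M := by positivity
  set c := ⌊M * ((2 * t ^ 2 : ℕ) + 1 : ℝ) ^ a⌋₊
  have hc : ∀ (G : SimpleGraph V) (S : Finset V), ¬ HasCliqueMinorOn G S t →
      S.card ≤ 2 * t ^ 2 → (G.cliquesIn S).card ≤ c := by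
    intro G S hS hcard
    refine Nat.le_floor ?_
    refine (card_cliquesIn_le_of_peel (q := peelRatio t) (a := a) (N := 2 * t ^ 2) (M := M)
      (by unfold peelRatio; omega) (by simp only [a]; unfold peelExponent; omega) hM0
      (peel_pow_mul_le_one t) _ rfl hcard ?_).trans ?_
    · intro T hT hdeg
      refine card_cliquesIn_le_of_dense hb3 hb2 (by linarith) (by unfold peelRatio; omega)
        (fun h => hS (h.mono hT)) ?_ hdeg
      exact ((Finset.card_le_card hT).trans hcard).trans_lt (Nat.lt_pow_succ_log_self (by norm_num) _)
    · refine mul_le_mul_of_nonneg_left (pow_le_pow_left₀ (Nat.cast_add_one_pos _).le ?_ _) hM0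
      have : (S.card : ℝ) ≤ (2 * t ^ 2 : ℕ) := Nat.cast_le.2 hcard
      linarith
  have hlin : ∀ (G : SimpleGraph V) (S : Finset V), ¬ HasCliqueMinorOn G S t →
      (G.cliquesIn S).card ≤ c * S.card + 1 :=
    fun G S hS => card_cliquesIn_le_linear ht hc _ G S rfl hS
  have hmain := card_image_neighbors_add_le hlin A.toFinset _ G (A.toFinset)ᶜ rfl
    disjoint_compl_right fun h => hG h.isMinorOf
  have hdiv := distDiversity_one_le_card (G := G) A
  have hpos := card_cliquesIn_pos (G := G) A.toFinset
  have hA : A.toFinset.card = A.ncard := (Set.ncard_eq_toFinset_card' A).symm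
  rw [hA] at hmain
  -- The main bound has additive term 2; the empty clique of `A` takes up one, leaving the `+ 1` of
  -- the theorem.
  have hnat : G.distDiversity 1 A ≤ 2 * c * A.ncard + 1 := by
    rw [mul_assoc]
    refine hdiv.trans ?_
    have h' : 2 * (c * A.ncard + 1) = 2 * (c * A.ncard) + 2 := by ring
    refine Nat.le_of_lt_succ (lt_of_lt_of_le ?_ (hmain.trans h'.le))
    convert Nat.lt_add_of_pos_right hpos
  -- The three error terms match the factor 2 from turning neighbourhoods into cliques, the squared
  -- codegree in `M`, and the polynomial loss of peeling.
  have hconst : (3 : ℝ) ^ (2 * (t : ℝ) / 3 + diversityError t)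
      = 2 * (M * ((2 * t ^ 2 : ℕ) + 1 : ℝ) ^ a) := by
    have e : 2 * (t : ℝ) / 3 + diversityError t = Real.logb 3 2
        + ((1 / 3 : ℝ) * ((2 * t + peelCodegree t ^ 2 : ℕ) : ℝ)
          + Real.logb 3 (2 * t ^ 2 + 1) * (a : ℝ)) := by
      unfold diversityError; push_cast; ring
    rw [e, Real.rpow_add (by norm_num), Real.rpow_add (by norm_num),
      Real.rpow_logb (by norm_num) (by norm_num) (by norm_num), Real.rpow_mul (by norm_num),
      Real.rpow_mul (by norm_num), Real.rpow_logb (by norm_num) (by norm_num) (by positivity),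
      Real.rpow_natCast, Real.rpow_natCast]
    push_cast
    rfl
  rw [hconst]
  have hcM : (c : ℝ) ≤ M * ((2 * t ^ 2 : ℕ) + 1 : ℝ) ^ a := Nat.floor_le (by positivity)
  calc (G.distDiversity 1 A : ℝ) ≤ 2 * c * A.ncard + 1 := by exact_mod_cast hnat
    _ ≤ _ := by gcongr

end UpperBound

/-! ### The lower bound construction -/

section LowerBound

theorem exists_adj_of_induce_connected {V : Type*} {G : SimpleGraph V} {B : Set V}
    (hB : (G.induce B).Connected) {x y : V} (hx : x ∈ B) (hy : y ∈ B) (hxy : x ≠ y) :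
    ∃ z ∈ B, G.Adj x z := by
  obtain ⟨w⟩ := hB.preconnected ⟨x, hx⟩ ⟨y, hy⟩
  cases w with
  | nil => exact absurd rfl hxy
  | @cons _ z _ h _ => exact ⟨z, z.2, by simpa using h⟩

open scoped Classical in
/-- If the vertices outside `A` are independent and have cliques as neighbourhoods, then a clique
minor is bounded in terms of the size and the clique number of `A`. -/
theorem le_of_completeGraph_isMinorOf {V : Type*} [Fintype V] {G : SimpleGraph V} {A : Finset V}
    {t w : ℕ} (hind : ∀ x y, x ∉ A → y ∉ A → ¬ G.Adj x y)
    (hnb : ∀ v, v ∉ A → ∀ x y, G.Adj v x → G.Adj v y → x ≠ y → G.Adj x y)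
    (hw : ∀ K ⊆ A, G.IsClique (K : Set V) → K.card ≤ w)
    (h : (completeGraph (Fin t)).IsMinorOf G) : 2 * t ≤ A.card + w ∨ t ≤ w + 1 := by
  obtain ⟨B, hc, hd, ha⟩ := h
  have ha' : ∀ i j, i ≠ j → ∃ x ∈ B i, ∃ y ∈ B j, G.Adj x y := fun i j hij => ha i j (by simpa using hij)
  have hd' : ∀ i j x, x ∈ B i → x ∈ B j → i = j := fun i j x hi hj => by
    by_contra hij
    exact Set.disjoint_left.1 (hd i j hij) hi hj
  by_cases hmeet : ∀ i, ∃ x ∈ A, x ∈ B i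
  · left
    choose a haA haB using hmeet
    have hainj : Function.Injective a := fun i j hij => hd' i j _ (haB i) (hij ▸ haB j)
    let C : Fin t → Finset V := fun i => A.filter (· ∈ B i)
    have haC : ∀ i, a i ∈ C i := fun i => Finset.mem_filter.2 ⟨haA i, haB i⟩
    -- The other branch sets use at least two vertices of `A`, so `2 * t ≤ A.card + I.card`. The
    -- single vertices for `i ∈ I` form a clique: a connection through a vertex outside `A` joins
    -- two of its neighbours, which are adjacent anyway.
    let I := Finset.univ.filter fun i => (C i).card = 1
    have honly : ∀ i ∈ I, ∀ x ∈ A, x ∈ B i → x = a i := by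
      intro i hi x hx hxB
      obtain ⟨z, hz⟩ := Finset.card_eq_one.1 (Finset.mem_filter.1 hi).2
      have h1 : x ∈ C i := Finset.mem_filter.2 ⟨hx, hxB⟩
      have h2 := haC i
      rw [hz, Finset.mem_singleton] at h1 h2
      rw [h1, h2]
    have hedge : ∀ i ∈ I, ∀ j ∈ I, i ≠ j → ∀ x ∈ B i, ∀ y ∈ B j, x ∉ A → G.Adj x y →
        G.Adj (a i) (a j) := by
      intro i hi j hj hij x hx y hy hxA hxy
      have hyA : y ∈ A := by
        by_contra h
        exact hind x y hxA h hxy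
      obtain rfl := honly j hj y hyA hy
      obtain ⟨z, hz, hxz⟩ := exists_adj_of_induce_connected (hc i) hx (haB i)
        fun h => hxA (h ▸ haA i)
      have hzA : z ∈ A := by
        by_contra h
        exact hind x z hxA h hxz
      obtain rfl := honly i hi z hzA hz
      exact hnb x hxA _ _ hxz hxy (hainj.ne hij)
    have hI : I.card ≤ w := by
      rw [← Finset.card_image_of_injective I hainj]
      refine hw _ (fun x hx => ?_) ?_
      · obtain ⟨i, -, rfl⟩ := Finset.mem_image.1 hx
        exact haA i
      · intro x hx y hy hxy
        obtain ⟨i, hi, rfl⟩ := Finset.mem_image.1 hx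
        obtain ⟨j, hj, rfl⟩ := Finset.mem_image.1 hy
        have hij : i ≠ j := fun h => hxy (by rw [h])
        obtain ⟨x, hx, y, hy, hxy⟩ := ha' i j hij
        by_cases hxA : x ∈ A
        · by_cases hyA : y ∈ A
          · rwa [← honly i hi x hxA hx, ← honly j hj y hyA hy]
          · exact (hedge j hj i hi hij.symm y hy x hx hyA hxy.symm).symm
        · exact hedge i hi j hj hij x hx y hy hxA hxy
    have hsum : ∑ i, (C i).card ≤ A.card := by
      rw [← Finset.card_biUnion]
      · exact Finset.card_le_card fun x hx => by
          obtain ⟨i, -, hi⟩ := Finset.mem_biUnion.1 hx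
          exact (Finset.mem_filter.1 hi).1
      · intro i _ j _ hij
        rw [Function.onFun, Finset.disjoint_left]
        intro x hx hy
        exact hij (hd' i j x (Finset.mem_filter.1 hx).2 (Finset.mem_filter.1 hy).2)
    have hIsum : I.card = ∑ i, if (C i).card = 1 then 1 else 0 := Finset.card_filter _ _
    have h2 : ∑ _i : Fin t, 2 ≤ ∑ i, ((C i).card + if (C i).card = 1 then 1 else 0) := by
      refine Finset.sum_le_sum fun i _ => ?_
      have : 0 < (C i).card := Finset.card_pos.2 ⟨_, haC i⟩
      split_ifs <;> omega
    rw [Finset.sum_add_distrib, ← hIsum] at h2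
    simp at h2
    omega
  · right
    push Not at hmeet
    obtain ⟨i, hi⟩ := hmeet
    obtain ⟨x, hx⟩ := (hc i).nonempty
    have hxA : x ∉ A := fun h => hi x h hx
    -- A connected set avoiding `A` is a single vertex, by independence. Its neighbours in the other
    -- branch sets then form a clique of size `t - 1`.
    have hsing : ∀ y ∈ B i, y = x := by
      intro y hy
      by_contra hyx
      obtain ⟨z, hz, hxz⟩ := exists_adj_of_induce_connected (hc i) hx hy (Ne.symm hyx)
      exact hind x z hxA (fun h => hi z h hz) hxz
    have hex : ∀ j, ∃ y, j ≠ i → y ∈ B j ∧ G.Adj x y := by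
      intro j
      by_cases hj : j = i
      · exact ⟨x, fun h => absurd hj h⟩
      · obtain ⟨z, hz, y, hy, hzy⟩ := ha' i j (Ne.symm hj)
        exact ⟨y, fun _ => ⟨hy, hsing z hz ▸ hzy⟩⟩
    choose y hy using hex
    have hinj : Set.InjOn y (Finset.univ.erase i : Finset (Fin t)) := by
      intro j hj k hk hjk
      simp only [Finset.coe_erase, Finset.coe_univ, Set.mem_sdiff, Set.mem_univ, true_and,
        Set.mem_singleton_iff] at hj hk
      exact hd' j k _ (hy j hj).1 (hjk ▸ (hy k hk).1)
    have hcard := hw ((Finset.univ.erase i).image y) (fun z hz => by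
      obtain ⟨j, hj, rfl⟩ := Finset.mem_image.1 hz
      by_contra h
      exact hind x _ hxA h (hy j (Finset.mem_erase.1 hj).1).2) (fun z hz z' hz' hne => by
      obtain ⟨j, hj, rfl⟩ := Finset.mem_image.1 hz
      obtain ⟨k, hk, rfl⟩ := Finset.mem_image.1 hz'
      exact hnb x hxA _ _ (hy j (Finset.mem_erase.1 hj).1).2 (hy k (Finset.mem_erase.1 hk).1).2 hne)
    rw [Finset.card_image_of_injOn hinj, Finset.card_erase_of_mem (Finset.mem_univ _),
      Finset.card_univ, Fintype.card_fin] at hcard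
    omega

/-- The cocktail party graph on `p` pairs of vertices, with a vertex added for each of its cliques
that is joined to this clique. -/
def cocktailCliqueGraph (p : ℕ) : SimpleGraph ((Fin p × Bool) ⊕ (Fin p → Option Bool)) where
  Adj
    | .inl x, .inl y => x.1 ≠ y.1
    | .inl x, .inr g => g x.1 = some x.2
    | .inr g, .inl x => g x.1 = some x.2
    | .inr _, .inr _ => False
  symm := ⟨by
    rintro (x | g) (y | h) hxy
    · exact Ne.symm hxy
    · exact hxy
    · exact hxy
    · exact hxy⟩
  loopless := ⟨by
    rintro (x | g) h
    · exact h rfl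
    · exact h⟩

theorem adj_iff_of_distProfile_eq {V : Type*} {G : SimpleGraph V} {A : Set V} {v v' w : V}
    (hv : v ∉ A) (hv' : v' ∉ A) (hw : w ∈ A) (h : G.distProfile 1 v A = G.distProfile 1 v' A) :
    G.Adj v w ↔ G.Adj v' w := by
  have h1 : (w, G.truncDist 1 v w) ∈ G.distProfile 1 v' A := h ▸ ⟨w, hw, rfl⟩
  obtain ⟨w', hw', he⟩ := h1
  obtain ⟨rfl, he⟩ := Prod.mk.inj he
  have hvw : v ≠ w := fun h => hv (h ▸ hw)
  have hvw' : v' ≠ w := fun h => hv' (h ▸ hw)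
  rw [truncDist_one_of_ne hvw, truncDist_one_of_ne hvw'] at he
  by_cases h1 : G.Adj v w <;> by_cases h2 : G.Adj v' w <;> simp_all

/-- A clique of the cocktail party graph picks neither or one vertex from each pair, so `Fin p →
Option Bool` enumerates the cliques and the attached vertices have `3 ^ p` distinct profiles. The
two inequalities exclude both outcomes of `le_of_completeGraph_isMinorOf`. -/
theorem exists_completeMinorFree_distDiversity_ge {p t : ℕ} (hp : 3 * p < 2 * t)
    (hpt : p + 1 < t) :
    ∃ (n : ℕ) (G : SimpleGraph (Fin n)) (A : Set (Fin n)), G.CompleteMinorFree t ∧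
      A.ncard = 2 * p ∧ 3 ^ p ≤ G.distDiversity 1 A := by
  classical
  let e := (Fintype.equivFin ((Fin p × Bool) ⊕ (Fin p → Option Bool))).symm
  let G := (cocktailCliqueGraph p).comap e
  let ι : Fin p × Bool ↪ Fin _ := Function.Embedding.inl.trans e.symm.toEmbedding
  let A : Finset (Fin _) := Finset.univ.map ι
  have hA : A.card = 2 * p := by
    simp [A, mul_comm]
  have hmem : ∀ x, x ∈ A ↔ ∃ z, e x = Sum.inl z := by
    intro x
    simp only [A, ι, Finset.mem_map, Finset.mem_univ, true_and]
    refine exists_congr fun z => ?_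
    simp only [Function.Embedding.trans_apply, Equiv.coe_toEmbedding, Function.Embedding.inl_apply]
    rw [Equiv.symm_apply_eq, eq_comm]
  have hnot : ∀ x, x ∉ A → ∃ g, e x = Sum.inr g := by
    intro x hx
    rw [hmem] at hx
    rcases h : e x with z | g
    · exact absurd ⟨z, h⟩ hx
    · exact ⟨g, rfl⟩
  have hadj : ∀ x y, G.Adj x y ↔ (cocktailCliqueGraph p).Adj (e x) (e y) := fun _ _ => Iff.rfl
  refine ⟨_, G, A, fun h => ?_, by rw [Set.ncard_coe_finset, hA], ?_⟩
  · suffices hsuff : 2 * t ≤ A.card + p ∨ t ≤ p + 1 by omega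
    refine le_of_completeGraph_isMinorOf (G := G) ?_ ?_ ?_ h
    · intro x y hx hy hxy
      obtain ⟨g, hg⟩ := hnot x hx
      obtain ⟨g', hg'⟩ := hnot y hy
      rw [hadj, hg, hg'] at hxy
      exact hxy
    · intro v hv x y hx hy hxy
      obtain ⟨g, hg⟩ := hnot v hv
      rw [hadj, hg] at hx hy
      rw [hadj]
      rcases hex : e x with ⟨i, b⟩ | g₁
      · rcases hey : e y with ⟨j, c⟩ | g₂
        · rw [hex] at hx
          rw [hey] at hy
          change g i = some b at hx
          change g j = some c at hy
          change i ≠ j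
          rintro rfl
          obtain rfl : b = c := Option.some.inj (hx.symm.trans hy)
          exact hxy (e.injective (hex.trans hey.symm))
        · rw [hey] at hy; exact hy.elim
      · rw [hex] at hx; exact hx.elim
    · intro K hK hc
      rcases K.eq_empty_or_nonempty with rfl | ⟨x₀, hx₀⟩
      · simp
      have : Nonempty (Fin p × Bool) := ⟨((hmem x₀).1 (hK hx₀)).choose⟩
      choose! z hz using fun x (hx : x ∈ K) => (hmem x).1 (hK hx)
      have hinj : Set.InjOn (fun x => (z x).1) (K : Set (Fin _)) := by
        intro x hx y hy hxy
        by_contra hne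
        have := hc hx hy hne
        rw [hadj, hz x hx, hz y hy] at this
        exact this hxy
      simpa using Finset.card_le_card_of_injOn (t := Finset.univ) (fun x => (z x).1)
        (fun _ _ => Finset.mem_coe.2 (Finset.mem_univ _)) hinj
  · let f : (Fin p → Option Bool) → Set (Fin _ × ℕ∞) :=
      fun g => G.distProfile 1 (e.symm (Sum.inr g)) A
    have hout : ∀ g, e.symm (Sum.inr g) ∉ (A : Set (Fin _)) := by
      intro g hg
      obtain ⟨z, hz⟩ := (hmem _).1 hg
      simp at hz
    have hf : Function.Injective f := by
      intro g g' h
      have key : ∀ i b, g i = some b ↔ g' i = some b := by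
        intro i b
        have := adj_iff_of_distProfile_eq (hout g) (hout g')
          (w := e.symm (Sum.inl (i, b))) ((hmem _).2 ⟨(i, b), by simp⟩) h
        rw [hadj, hadj, Equiv.apply_symm_apply, Equiv.apply_symm_apply, Equiv.apply_symm_apply] at this
        exact this
      funext i
      exact Option.ext (key i)
    have hcard : (f '' Set.univ).ncard = 3 ^ p := by
      rw [Set.ncard_image_of_injective _ hf, Set.ncard_univ]
      simp
    rw [← hcard]
    refine Set.ncard_le_ncard ?_ ?_
    · rintro _ ⟨g, -, rfl⟩
      exact ⟨_, hout g, rfl⟩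
    · refine (Set.finite_range fun v => G.distProfile 1 v A).subset ?_
      rintro P ⟨v, -, rfl⟩
      exact ⟨v, rfl⟩

/-- A trivial example for small `t`, where the target bound is at most 1. -/
theorem exists_completeMinorFree_one_le_distDiversity {t : ℕ} (ht : 2 ≤ t) :
    ∃ (n : ℕ) (G : SimpleGraph (Fin n)) (A : Set (Fin n)), G.CompleteMinorFree t ∧
      A.ncard = 1 ∧ 1 ≤ G.distDiversity 1 A := by
  refine ⟨2, ⊥, {0}, ?_, by simp, ?_⟩
  · rintro ⟨B, -, -, ha⟩
    obtain ⟨x, -, y, -, hxy⟩ := ha ⟨0, by omega⟩ ⟨1, by omega⟩ (by simp [completeGraph])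
    exact hxy
  · rw [distDiversity, Nat.one_le_iff_ne_zero, ← Nat.pos_iff_ne_zero, Set.ncard_pos ?_]
    · exact ⟨_, 1, by simp, rfl⟩
    · refine (Set.finite_range fun v => (⊥ : SimpleGraph (Fin 2)).distProfile 1 v {0}).subset ?_
      rintro P ⟨v, -, rfl⟩
      exact ⟨v, rfl⟩

/-- The error term in the exponent of the lower bound. -/
noncomputable def diversityDefect (t : ℕ) : ℝ := 4 + Real.logb 3 (2 * t)

theorem diversityDefect_isBigO :
    diversityDefect =O[atTop] fun t : ℕ => Real.log (t : ℝ) := by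
  refine IsBigO.of_bound 6 ?_
  filter_upwards [eventually_ge_atTop 3] with t ht
  have ht' : (3 : ℝ) ≤ t := by exact_mod_cast ht
  have h3 : 1 ≤ Real.log 3 := by
    rw [Real.le_log_iff_exp_le (by norm_num)]
    exact Real.exp_one_lt_d9.le.trans (by norm_num)
  have hl1 : 1 ≤ Real.log t := h3.trans (Real.log_le_log (by norm_num) ht')
  have h2t : 0 ≤ Real.log (2 * t) := Real.log_nonneg (by linarith)
  have h1 : Real.logb 3 (2 * t) ≤ Real.log (2 * t) := div_le_self h2t h3
  have h0 : 0 ≤ Real.logb 3 (2 * t) := div_nonneg h2t (by linarith)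
  rw [Real.log_mul (by norm_num) (by linarith)] at h1
  have := Real.log_two_lt_d9
  rw [diversityDefect, Real.norm_of_nonneg (by linarith), Real.norm_of_nonneg (by linarith)]
  linarith

/-- The largest `p` with `3 * p < 2 * t` satisfies `2 * t / 3 ≤ p + 1`. In the defect, `logb 3 (2 *
t)` pays for the factor `A.ncard = 2 * p`, and the constant 4 pays for the rounding and makes the
exponent nonpositive when `t < 5`. -/
theorem exists_completeMinorFree_le_distDiversity {t : ℕ} (ht : 2 ≤ t) :
    ∃ (n : ℕ) (G : SimpleGraph (Fin n)) (A : Set (Fin n)),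
      G.CompleteMinorFree t ∧ A.Nonempty ∧
        (3 : ℝ) ^ (2 * (t : ℝ) / 3 - diversityDefect t) * (A.ncard : ℝ)
          ≤ (G.distDiversity 1 A : ℝ) := by
  have ht' : (2 : ℝ) ≤ t := by exact_mod_cast ht
  have hlog : 0 ≤ Real.logb 3 (2 * t) := Real.logb_nonneg (by norm_num) (by linarith)
  by_cases h5 : t < 5
  · obtain ⟨n, G, A, hG, hA, hd⟩ := exists_completeMinorFree_one_le_distDiversity ht
    refine ⟨n, G, A, hG, Set.nonempty_of_ncard_ne_zero (by omega), ?_⟩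
    have h1 : (3 : ℝ) ^ (2 * (t : ℝ) / 3 - diversityDefect t) ≤ 1 := by
      refine Real.rpow_le_one_of_one_le_of_nonpos (by norm_num) ?_
      have : (t : ℝ) < 5 := by exact_mod_cast h5
      unfold diversityDefect
      linarith
    have h2 : (1 : ℝ) ≤ G.distDiversity 1 A := by exact_mod_cast hd
    rw [hA]
    simpa using h1.trans h2
  · obtain ⟨n, G, A, hG, hA, hd⟩ := exists_completeMinorFree_distDiversity_ge
      (p := (2 * t - 1) / 3) (t := t) (by omega) (by omega)
    set p := (2 * t - 1) / 3
    refine ⟨n, G, A, hG, Set.nonempty_of_ncard_ne_zero (by omega), ?_⟩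
    have hp1 : 2 * (t : ℝ) ≤ 3 * p + 3 := by
      have : 2 * t ≤ 3 * p + 3 := by omega
      exact_mod_cast this
    have hp2 : 2 * (p : ℝ) ≤ 2 * t := by
      have : 2 * p ≤ 2 * t := by omega
      exact_mod_cast this
    have hd' : (3 : ℝ) ^ p ≤ G.distDiversity 1 A := by exact_mod_cast hd
    rw [hA]
    push_cast
    calc (3 : ℝ) ^ (2 * (t : ℝ) / 3 - diversityDefect t) * (2 * p)
        ≤ (3 : ℝ) ^ ((p : ℝ) - Real.logb 3 (2 * t)) * (2 * t) := by
          refine mul_le_mul (Real.rpow_le_rpow_of_exponent_le (by norm_num) ?_) hp2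
            (by positivity) (by positivity)
          unfold diversityDefect
          linarith
      _ = (3 : ℝ) ^ p := by
          rw [Real.rpow_sub (by norm_num), Real.rpow_logb (by norm_num) (by norm_num)
            (by linarith), Real.rpow_natCast, div_mul_cancel₀ _ (by linarith)]
      _ ≤ _ := hd'

end LowerBound

end SimpleGraph

theorem corollary3p6 :
    -- the upper bound
    (∃ ε : ℕ → ℝ, ε =o[atTop] (fun t : ℕ => (t : ℝ)) ∧
      ∀ (t : ℕ) (V : Type*) [Finite V] (G : SimpleGraph V), G.CompleteMinorFree t →
        ∀ A : Set V,
          (G.distDiversity 1 A : ℝ) ≤ (3 : ℝ) ^ (2 * (t : ℝ) / 3 + ε t) * (A.ncard : ℝ) + 1) ∧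
    -- tightness
    (∃ δ : ℕ → ℝ, δ =O[atTop] (fun t : ℕ => Real.log (t : ℝ)) ∧
      ∀ t : ℕ, 2 ≤ t →
        ∃ (n : ℕ) (G : SimpleGraph (Fin n)) (A : Set (Fin n)),
          G.CompleteMinorFree t ∧ A.Nonempty ∧
            (3 : ℝ) ^ (2 * (t : ℝ) / 3 - δ t) * (A.ncard : ℝ) ≤ (G.distDiversity 1 A : ℝ)) := by
  exact ⟨⟨SimpleGraph.diversityError, SimpleGraph.diversityError_isLittleO,
      fun _ _ _ _ hG A => SimpleGraph.distDiversity_one_le hG A⟩,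
    ⟨SimpleGraph.diversityDefect, SimpleGraph.diversityDefect_isBigO,
      fun _ ht => SimpleGraph.exists_completeMinorFree_le_distDiversity ht⟩⟩
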